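/- Let $K$ be a field and let $K\langle x_1,\dots,x_n\rangle$ be the ring of non-commutative polynomials. Monomials are words in $x_1,\dots,x_n$ (including the empty word $1$), and $\deg$ of a word is its length. Fix an admissible ordering of the monomials, that is, a well-ordering (total) such that $m<m'$ implies $um<um'$ and $mu<m'u$ for all monomials $u$. For $f\neq 0$ let $\mathrm{lt}(f)$ be the greatest monomial occurring in $f$ and $\mathrm{lc}(f)\in K$ its coefficient. For nonzero $f,g$ and monomials $m_1,m_2$ with $\mathrm{lt}(f)=m_1\,\mathrm{lt}(g)\,m_2$, the polynomial $R_g(f)=f-\frac{\mathrm{lc}(f)}{\mathrm{lc}(g)}m_1gm_2$ is called a reduction of $f$ with respect to $g$ (there is one for each such pair $(m_1,m_2)$). For nonzero $f,g$ and monomials $m_1,m_2$ with $\mathrm{lt}(f)m_2=m_1\mathrm{lt}(g)$ and $\deg m_1<\deg \mathrm{lt}(f)$ (a small common multiple of $\mathrm{lt}(f),\mathrm{lt}(g)$), the corresponding S-polynomial is $S(f,g)=\frac1{\mathrm{lc}(f)}fm_2-\frac1{\mathrm{lc}(g)}m_1g$. A polynomial can be reduced to $0$ modulo a set $G$ if a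 finite (possibly empty) sequence of successive reductions with respect to elements of $G$ takes it to $0$. A subset $G$ of a two-sided ideal $I$ is a Gröbner basis of $I$ if for every nonzero $f\in I$ there are a nonzero $g\in G$ and monomials $m_1,m_2$ with $\mathrm{lt}(f)=m_1\mathrm{lt}(g)m_2$. **Lemma (Diamond lemma, non-commutative case).** Let $I$ be a two-sided ideal of $K\langle x_1,\dots,x_n\rangle$ and $G\subseteq I$ a (possibly infinite) subset. Then $G$ is a Gröbner basis of $I$ if and only if the following three conditions hold: 1. $G$ generates $I$ as a two-sided ideal; 2. for all $g_1,g_2\in G$ (possibly equal), every reduction $R_{g_2}(g_1)$ can be reduced to $0$ modulo $G$; 3. for all $g_1,g_2\in G$ (possibly equal) and every small common multiple of $\mathrm{lt}(g_1),\mathrm{lt}(g_2)$, the corresponding S-polynomial $S(g_1,g_2)$ can be reduced to $0$ modulo $G$. -/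

import Mathlib

namespace NCGroebner

/-- The ring `K⟨x₁,…,xₙ⟩` of non-commutative polynomials: finite linear combinations of words
(elements of the free monoid on `n` letters), multiplied by concatenating words. -/
abbrev NCPoly (K : Type*) [Field K] (n : ℕ) : Type _ := MonoidAlgebra K (FreeMonoid (Fin n))

section

variable {K : Type*} [Field K] {n : ℕ}

/-- A word regarded as a polynomial. -/
noncomputable def mon (m : FreeMonoid (Fin n)) : NCPoly K n := MonoidAlgebra.of K _ m

variable [LinearOrder (FreeMonoid (Fin n))]

/-- The leading monomial `lt(f)`: the greatest word occurring in `f`.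
The value at `f = 0` is irrelevant; all uses below require `f ≠ 0`. -/
noncomputable def lt (f : NCPoly K n) : FreeMonoid (Fin n) :=
  if h : f.coeff.support.Nonempty then f.coeff.support.max' h else 1

/-- The leading coefficient `lc(f)`: the coefficient of `lt(f)` in `f`. -/
noncomputable def lc (f : NCPoly K n) : K := f.coeff (lt f)

/-- `r` is a reduction `R_g(f)` of `f` with respect to `g`, for one of the ways of writing
`lt(f) = m₁ lt(g) m₂`. -/
def IsReduction (g f r : NCPoly K n) : Prop :=
  f ≠ 0 ∧ g ≠ 0 ∧ ∃ m₁ m₂ : FreeMonoid (Fin n),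
    lt f = m₁ * lt g * m₂ ∧ r = f - (lc f / lc g) • (mon m₁ * g * mon m₂)

/-- `s` is the S-polynomial `S(f,g)` with respect to some small common multiple
`lt(f) m₂ = m₁ lt(g)`, `deg m₁ < deg lt(f)`. -/
def IsSPolynomial (f g s : NCPoly K n) : Prop :=
  f ≠ 0 ∧ g ≠ 0 ∧ ∃ m₁ m₂ : FreeMonoid (Fin n),
    lt f * m₂ = m₁ * lt g ∧ m₁.length < (lt f).length ∧
      s = (lc f)⁻¹ • (f * mon m₂) - (lc g)⁻¹ • (mon m₁ * g)

/-- `f` can be reduced to `0` modulo `G`: finitely many (possibly no) successive reductions with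
respect to elements of `G` lead from `f` to `0`. -/
def ReducesToZero (G : Set (NCPoly K n)) (f : NCPoly K n) : Prop :=
  Relation.ReflTransGen (fun a b => ∃ g ∈ G, IsReduction g a b) f 0

/-- `G` is a Gröbner basis of the two-sided ideal `I`. -/
def IsGroebnerBasis (G : Set (NCPoly K n)) (I : TwoSidedIdeal (NCPoly K n)) : Prop :=
  G ⊆ (I : Set (NCPoly K n)) ∧
    ∀ f ∈ I, f ≠ 0 → ∃ g ∈ G, g ≠ 0 ∧
      ∃ m₁ m₂ : FreeMonoid (Fin n), lt f = m₁ * lt g * m₂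

end

end NCGroebner

/-!
The easy direction is termination: a reduction strictly lowers the leading monomial, so, the
monomial order being a well-order, every element of `I` reduces to `0` once every nonzero
element of `I` has a leading monomial divisible by some `lt g`; conversely a polynomial that
reduces to `0` lies in the ideal generated by `G`.

For the other direction, filter the ideal generated by `G` by subspaces: for a set `s` of words,
`standardSpan G s` is spanned by the products `a * g * b` (`a`, `b` words, `0 ≠ g ∈ G`) whose
leading monomial `a * lt g * b` lies in `s`. The heart of the proof is
`normalized_sub_mem_standardSpan`: two such products with the same leading monomial `w`, each
divided by its leading coefficient, differ by an element of `standardSpan G (Iio w)`. The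
occurrences of `lt g₁` and `lt g₂` in `w` either are disjoint, overlap, or are nested. Overlaps
are S-polynomials and nested occurrences are reductions, which reduce to `0` by assumption, and
disjoint occurrences are handled by a direct computation (`disjoint_sub_mem_standardSpan`).

Hence modulo `standardSpan G (Iio w)` the space `standardSpan G (Iic w)` is at most a line,
spanned by a product with leading monomial `w`. An element of it therefore either has leading
monomial `w`, which is divisible by some `lt g`, or lies in `standardSpan G (Iic w')` for some
`w' < w`, and well-founded induction on `w` finishes the proof.
-/

namespace NCGroebner

open Set

variable {K : Type*} [Field K] {n : ℕ}

/-! ### Words as polynomials -/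

lemma mon_one : (mon 1 : NCPoly K n) = 1 := map_one _

lemma mon_mul (a b : FreeMonoid (Fin n)) : (mon (a * b) : NCPoly K n) = mon a * mon b :=
  map_mul _ _ _

lemma coeff_mon_self (w : FreeMonoid (Fin n)) : (mon w : NCPoly K n).coeff w = 1 := by
  simp [mon]

lemma coeff_mon_of_ne {u w : FreeMonoid (Fin n)} (h : w ≠ u) :
    (mon w : NCPoly K n).coeff u = 0 := by
  classical
  simp [mon, h]

lemma eq_sum_smul_mon (f : NCPoly K n) :
    f = ∑ u ∈ f.coeff.support, f.coeff u • (mon u : NCPoly K n) := by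
  conv_lhs => rw [← MonoidAlgebra.sum_coeff_single f]
  simp [mon, Finsupp.sum]

/-- Two factorizations `x * y = z * w` of a word have a common refinement. -/
lemma exists_of_mul_eq_mul {x y z w : FreeMonoid (Fin n)} (h : x * y = z * w) :
    (∃ c, z = x * c ∧ y = c * w) ∨ ∃ c, x = z * c ∧ w = c * y :=
  List.append_eq_append_iff.1 h

/-! ### Leading monomials -/

variable [LinearOrder (FreeMonoid (Fin n))]

variable (K) in
/-- The space of polynomials all of whose monomials are smaller than `w`. -/
noncomputable def below (w : FreeMonoid (Fin n)) : Submodule K (NCPoly K n) :=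
  Submodule.span K (mon '' Iio w)

lemma mon_mem_below {u w : FreeMonoid (Fin n)} (h : u < w) : (mon u : NCPoly K n) ∈ below K w :=
  Submodule.subset_span ⟨u, h, rfl⟩

lemma mem_below_iff {w : FreeMonoid (Fin n)} {f : NCPoly K n} :
    f ∈ below K w ↔ ∀ u, f.coeff u ≠ 0 → u < w := by
  constructor
  · intro hf
    induction hf using Submodule.span_induction with
    | mem x hx =>
      obtain ⟨v, hv, rfl⟩ := hx
      intro u hu
      by_cases h : v = u
      · exact h ▸ hv
      · exact absurd (coeff_mon_of_ne h) hu
    | zero => simp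
    | add x y _ _ hx hy =>
      intro u hu
      by_cases h : x.coeff u = 0
      · exact hy u fun h' => hu (by simp [h, h'])
      · exact hx u h
    | smul c x _ hx =>
      intro u hu
      exact hx u fun h => hu (by simp [h])
  · intro h
    rw [eq_sum_smul_mon f]
    exact Submodule.sum_mem _ fun u hu =>
      Submodule.smul_mem _ _ (mon_mem_below (h u (Finsupp.mem_support_iff.1 hu)))

lemma below_mono {u w : FreeMonoid (Fin n)} (h : u ≤ w) : below K u ≤ below K w :=
  fun _ hf => mem_below_iff.2 fun v hv => (mem_below_iff.1 hf v hv).trans_le h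

lemma coeff_eq_zero_of_mem_below {w : FreeMonoid (Fin n)} {f : NCPoly K n}
    (hf : f ∈ below K w) : f.coeff w = 0 := by
  by_contra h
  exact lt_irrefl _ (mem_below_iff.1 hf w h)

lemma lt_eq_max' {f : NCPoly K n} (hf : f ≠ 0) :
    ∃ h : f.coeff.support.Nonempty, lt f = f.coeff.support.max' h := by
  have h : f.coeff.support.Nonempty := by simpa [Finsupp.support_nonempty_iff] using hf
  exact ⟨h, by simp [lt, h]⟩

lemma lc_ne_zero {f : NCPoly K n} (hf : f ≠ 0) : lc f ≠ 0 := by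
  obtain ⟨h, e⟩ := lt_eq_max' hf
  rw [lc, e]
  exact Finsupp.mem_support_iff.1 (Finset.max'_mem _ h)

lemma le_lt {f : NCPoly K n} {u : FreeMonoid (Fin n)} (hu : f.coeff u ≠ 0) : u ≤ lt f := by
  have hf : f ≠ 0 := by rintro rfl; simp at hu
  obtain ⟨h, e⟩ := lt_eq_max' hf
  rw [e]
  exact Finset.le_max' _ _ (Finsupp.mem_support_iff.2 hu)

lemma lt_lt_of_mem_below {w : FreeMonoid (Fin n)} {f : NCPoly K n} (hf : f ≠ 0)
    (h : f ∈ below K w) : lt f < w :=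
  mem_below_iff.1 h _ (lc_ne_zero hf)

/-- A polynomial is its leading term plus a polynomial with smaller monomials. -/
lemma sub_lc_smul_mem_below (f : NCPoly K n) : f - lc f • mon (lt f) ∈ below K (lt f) := by
  refine mem_below_iff.2 fun u hu => ?_
  have hne : lt f ≠ u := by
    rintro rfl
    simp [coeff_mon_self, lc] at hu
  refine lt_of_le_of_ne (le_lt fun h => hu ?_) hne.symm
  simp [coeff_mon_of_ne hne, h]

lemma inv_lc_smul_sub_mem_below {f : NCPoly K n} (hf : f ≠ 0) :
    (lc f)⁻¹ • f - mon (lt f) ∈ below K (lt f) := by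
  have := (below K (lt f)).smul_mem (lc f)⁻¹ (sub_lc_smul_mem_below f)
  rwa [smul_sub, smul_smul, inv_mul_cancel₀ (lc_ne_zero hf), one_smul] at this

lemma lt_eq_of_sub_mem_below {w : FreeMonoid (Fin n)} {c : K} {f : NCPoly K n} (hc : c ≠ 0)
    (h : f - c • mon w ∈ below K w) : lt f = w := by
  have hw : f.coeff w = c := by
    have := coeff_eq_zero_of_mem_below h
    simpa [coeff_mon_self, sub_eq_zero] using this
  have hle : w ≤ lt f := le_lt (hw ▸ hc)
  refine le_antisymm (not_lt.1 fun hlt => ?_) hle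
  have hf : f ≠ 0 := by rintro rfl; exact hc (by simpa using hw.symm)
  refine lt_irrefl _ ((mem_below_iff.1 h (lt f) ?_).trans hlt)
  simpa [coeff_mon_of_ne hlt.ne, lc] using lc_ne_zero hf

/-! ### Spans of multiples of elements of `G` -/

/-- The span of the products `a * g * b`, with `a`, `b` words and `g` a nonzero element of `G`,
whose leading monomial `a * lt g * b` belongs to `s`. -/
noncomputable def standardSpan (G : Set (NCPoly K n)) (s : Set (FreeMonoid (Fin n))) :
    Submodule K (NCPoly K n) :=
  Submodule.span K {p | ∃ g ∈ G, g ≠ 0 ∧ ∃ a b : FreeMonoid (Fin n),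
    a * lt g * b ∈ s ∧ p = mon a * g * mon b}

variable {G : Set (NCPoly K n)}

lemma standardSpan_mono {s t : Set (FreeMonoid (Fin n))} (h : s ⊆ t) :
    standardSpan G s ≤ standardSpan G t :=
  Submodule.span_mono fun _ ⟨g, hg, hg0, a, b, hs, e⟩ => ⟨g, hg, hg0, a, b, h hs, e⟩

lemma mul_mul_mem_standardSpan {s : Set (FreeMonoid (Fin n))} {g : NCPoly K n} (hg : g ∈ G)
    (hg0 : g ≠ 0) {a b : FreeMonoid (Fin n)} (h : a * lt g * b ∈ s) :
    mon a * g * mon b ∈ standardSpan G s :=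
  Submodule.subset_span ⟨g, hg, hg0, a, b, h, rfl⟩

lemma mon_mul_mul_mon_mem_standardSpan {s t : Set (FreeMonoid (Fin n))}
    {a b : FreeMonoid (Fin n)} (hst : ∀ w ∈ s, a * w * b ∈ t) {f : NCPoly K n}
    (hf : f ∈ standardSpan G s) : mon a * f * mon b ∈ standardSpan G t := by
  induction hf using Submodule.span_induction with
  | mem x hx =>
    obtain ⟨g, hg, hg0, c, d, hs, rfl⟩ := hx
    have e : mon a * (mon c * g * mon d) * mon b = mon (a * c) * g * mon (d * b) := by
      simp only [mon_mul, mul_assoc]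
    rw [e]
    refine mul_mul_mem_standardSpan hg hg0 ?_
    have := hst _ hs
    simpa only [mul_assoc] using this
  | zero => simp
  | add x y _ _ hx hy =>
    rw [mul_add, add_mul]
    exact add_mem hx hy
  | smul c x _ hx =>
    rw [mul_smul_comm, smul_mul_assoc]
    exact Submodule.smul_mem _ _ hx

/-- An element of `standardSpan G s`, being a finite combination, only involves products whose
leading monomials are bounded by some element of `s`. -/
lemma eq_zero_or_exists_mem_standardSpan_Iic {s : Set (FreeMonoid (Fin n))} {f : NCPoly K n}
    (hf : f ∈ standardSpan G s) : f = 0 ∨ ∃ w ∈ s, f ∈ standardSpan G (Iic w) := by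
  induction hf using Submodule.span_induction with
  | mem x hx =>
    obtain ⟨g, hg, hg0, a, b, hs, rfl⟩ := hx
    exact Or.inr ⟨_, hs, mul_mul_mem_standardSpan hg hg0 self_mem_Iic⟩
  | zero => exact Or.inl rfl
  | add x y _ _ hx hy =>
    rcases hx with rfl | ⟨u, hu, hx⟩
    · simpa using hy
    rcases hy with rfl | ⟨v, hv, hy⟩
    · simpa using Or.inr ⟨u, hu, hx⟩
    rcases le_total u v with h | h
    · exact Or.inr ⟨v, hv, add_mem (standardSpan_mono (Iic_subset_Iic.2 h) hx) hy⟩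
    · exact Or.inr ⟨u, hu, add_mem hx (standardSpan_mono (Iic_subset_Iic.2 h) hy)⟩
  | smul c x _ hx =>
    rcases hx with rfl | ⟨u, hu, hx⟩
    · simp
    · exact Or.inr ⟨u, hu, Submodule.smul_mem _ _ hx⟩

lemma mem_standardSpan_univ_of_mem_span {f : NCPoly K n} (hf : f ∈ TwoSidedIdeal.span G) :
    f ∈ standardSpan G univ := by
  have hl : ∀ {x y : NCPoly K n}, y ∈ standardSpan G univ → x * y ∈ standardSpan G univ := by
    intro x y hy
    rw [eq_sum_smul_mon x, Finset.sum_mul]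
    refine Submodule.sum_mem _ fun u _ => ?_
    rw [smul_mul_assoc]
    refine Submodule.smul_mem _ _ ?_
    simpa [mon_one] using
      mon_mul_mul_mon_mem_standardSpan (a := u) (b := 1) (t := univ) (fun _ _ => mem_univ _) hy
  have hr : ∀ {x y : NCPoly K n}, x ∈ standardSpan G univ → x * y ∈ standardSpan G univ := by
    intro x y hx
    rw [eq_sum_smul_mon y, Finset.mul_sum]
    refine Submodule.sum_mem _ fun u _ => ?_
    rw [mul_smul_comm]
    refine Submodule.smul_mem _ _ ?_
    simpa [mon_one] using
      mon_mul_mul_mon_mem_standardSpan (a := 1) (b := u) (t := univ) (fun _ _ => mem_univ _) hx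
  let J : TwoSidedIdeal (NCPoly K n) := TwoSidedIdeal.mk' (standardSpan G univ)
    (zero_mem _) add_mem neg_mem hl hr
  have hJ : TwoSidedIdeal.span G ≤ J := by
    refine TwoSidedIdeal.span_le.2 fun g hg => ?_
    by_cases hg0 : g = 0
    · exact hg0 ▸ zero_mem J
    · refine (TwoSidedIdeal.mem_mk' _ _ _ _ _ _ _).2 ?_
      simpa [mon_one] using
        mul_mul_mem_standardSpan (a := 1) (b := 1) (s := univ) hg hg0 (mem_univ _)
  exact (TwoSidedIdeal.mem_mk' _ _ _ _ _ _ _).1 (hJ hf)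

lemma mul_mul_mem_standardSpan_of_right_mem_below
    [MulLeftStrictMono (FreeMonoid (Fin n))] {g h : NCPoly K n} (hg : g ∈ G) (hg0 : g ≠ 0)
    {d w : FreeMonoid (Fin n)} (hh : h ∈ below K w) :
    g * mon d * h ∈ standardSpan G (Iio (lt g * d * w)) := by
  induction hh using Submodule.span_induction with
  | mem x hx =>
    obtain ⟨u, hu, rfl⟩ := hx
    have e : g * mon d * mon u = mon 1 * g * mon (d * u) := by
      rw [mon_mul, mul_assoc, mon_one, one_mul]
    rw [e]
    refine mul_mul_mem_standardSpan hg hg0 ?_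
    rw [one_mul, ← mul_assoc]
    exact mul_lt_mul_right hu _
  | zero => simp
  | add x y _ _ hx hy =>
    rw [mul_add]
    exact add_mem hx hy
  | smul c x _ hx =>
    rw [mul_smul_comm]
    exact Submodule.smul_mem _ _ hx

lemma mul_mul_mem_standardSpan_of_left_mem_below
    [MulRightStrictMono (FreeMonoid (Fin n))] {g h : NCPoly K n} (hg : g ∈ G) (hg0 : g ≠ 0)
    {d w : FreeMonoid (Fin n)} (hh : h ∈ below K w) :
    h * mon d * g ∈ standardSpan G (Iio (w * d * lt g)) := by
  induction hh using Submodule.span_induction with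
  | mem x hx =>
    obtain ⟨u, hu, rfl⟩ := hx
    have e : mon u * mon d * g = mon (u * d) * g * mon 1 := by
      rw [mon_mul, mon_one, mul_one]
    rw [e]
    refine mul_mul_mem_standardSpan hg hg0 ?_
    rw [mul_one]
    exact mul_lt_mul_left (mul_lt_mul_left hu _) _
  | zero => simp
  | add x y _ _ hx hy =>
    rw [add_mul, add_mul]
    exact add_mem hx hy
  | smul c x _ hx =>
    rw [smul_mul_assoc, smul_mul_assoc]
    exact Submodule.smul_mem _ _ hx

/-! ### Reductions and two-sided ideals -/

lemma IsReduction.mem_iff {I : TwoSidedIdeal (NCPoly K n)} {f g r : NCPoly K n}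
    (h : IsReduction g f r) (hg : g ∈ I) : r ∈ I ↔ f ∈ I := by
  obtain ⟨-, -, a, b, -, rfl⟩ := h
  have hm : (lc f / lc g) • (mon a * g * mon b) ∈ I := by
    rw [← smul_mul_assoc, ← smul_mul_assoc]
    exact I.mul_mem_right _ _ (I.mul_mem_left _ _ hg)
  exact ⟨fun h => by simpa using I.add_mem h hm, fun h => I.sub_mem h hm⟩

lemma ReducesToZero.mem {I : TwoSidedIdeal (NCPoly K n)} (hG : G ⊆ (I : Set (NCPoly K n)))
    {f : NCPoly K n} (h : ReducesToZero G f) : f ∈ I := by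
  induction h using Relation.ReflTransGen.head_induction_on with
  | refl => exact I.zero_mem
  | head hac _ ih =>
    obtain ⟨g, hg, hr⟩ := hac
    exact (hr.mem_iff (hG hg)).1 ih

/-! ### The effect of multiplication on the order -/

section Ordered

variable [MulLeftStrictMono (FreeMonoid (Fin n))] [MulRightStrictMono (FreeMonoid (Fin n))]

lemma mul_mul_lt_mul_mul {u w : FreeMonoid (Fin n)} (h : u < w) (a b : FreeMonoid (Fin n)) :
    a * u * b < a * w * b :=
  mul_lt_mul_left (mul_lt_mul_right h a) b

lemma mon_mul_mul_mon_mem_below {w : FreeMonoid (Fin n)} {f : NCPoly K n} (hf : f ∈ below K w)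
    (a b : FreeMonoid (Fin n)) : mon a * f * mon b ∈ below K (a * w * b) := by
  induction hf using Submodule.span_induction with
  | mem x hx =>
    obtain ⟨u, hu, rfl⟩ := hx
    rw [← mon_mul, ← mon_mul]
    exact mon_mem_below (mul_mul_lt_mul_mul hu a b)
  | zero => simp
  | add x y _ _ hx hy =>
    rw [mul_add, add_mul]
    exact add_mem hx hy
  | smul c x _ hx =>
    rw [mul_smul_comm, smul_mul_assoc]
    exact Submodule.smul_mem _ _ hx

lemma mul_mul_sub_mem_below (g : NCPoly K n) (a b : FreeMonoid (Fin n)) :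
    mon a * g * mon b - lc g • mon (a * lt g * b) ∈ below K (a * lt g * b) := by
  have := mon_mul_mul_mon_mem_below (sub_lc_smul_mem_below g) a b
  rwa [mul_sub, sub_mul, mul_smul_comm, smul_mul_assoc, ← mon_mul, ← mon_mul] at this

lemma standardSpan_Iio_le_below (w : FreeMonoid (Fin n)) :
    standardSpan G (Iio w) ≤ below K w := by
  refine Submodule.span_le.2 ?_
  rintro _ ⟨g, -, -, a, b, h, rfl⟩
  have h1 := below_mono (K := K) (mem_Iio.1 h).le (mul_mul_sub_mem_below g a b)
  have h2 := (below K w).smul_mem (lc g) (mon_mem_below (K := K) (mem_Iio.1 h))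
  simpa using add_mem h1 h2

/-- A reduction cancels the leading term. -/
lemma IsReduction.mem_below {f g r : NCPoly K n} (h : IsReduction g f r) :
    r ∈ below K (lt f) := by
  obtain ⟨hf, hg, a, b, e, rfl⟩ := h
  have h1 := sub_lc_smul_mem_below f
  have h2 := (below K (lt f)).smul_mem (lc f / lc g) (e ▸ mul_mul_sub_mem_below g a b)
  rw [smul_sub, smul_smul, div_mul_cancel₀ _ (lc_ne_zero hg)] at h2
  convert sub_mem h1 h2 using 1
  abel

/-- An S-polynomial cancels the leading terms. -/
lemma sPolynomial_mem_below {f g : NCPoly K n} (hf : f ≠ 0) (hg : g ≠ 0)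
    {a b : FreeMonoid (Fin n)} (e : lt f * b = a * lt g) :
    (lc f)⁻¹ • (f * mon b) - (lc g)⁻¹ • (mon a * g) ∈ below K (lt f * b) := by
  have h1 := mon_mul_mul_mon_mem_below (inv_lc_smul_sub_mem_below hf) 1 b
  have h2 := mon_mul_mul_mon_mem_below (inv_lc_smul_sub_mem_below hg) a 1
  simp only [one_mul, mul_one, mon_one, sub_mul, mul_sub, smul_mul_assoc, mul_smul_comm,
    ← mon_mul] at h1 h2
  rw [← e] at h2
  convert sub_mem h1 h2 using 1
  abel

/-! ### Reduction to zero -/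

/-- A polynomial with monomials below `w` that reduces to `0` is a combination of products with
leading monomials below `w`. -/
lemma ReducesToZero.mem_standardSpan {f : NCPoly K n} (h : ReducesToZero G f)
    {w : FreeMonoid (Fin n)} (hw : f ∈ below K w) : f ∈ standardSpan G (Iio w) := by
  induction h using Relation.ReflTransGen.head_induction_on with
  | refl => exact zero_mem _
  | @head f' _ hac _ ih =>
    obtain ⟨g, hg, hr⟩ := hac
    have hlt := lt_lt_of_mem_below hr.1 hw
    have hrw := ih (below_mono hlt.le hr.mem_below)
    obtain ⟨-, hg0, a, b, e, rfl⟩ := hr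
    have := Submodule.smul_mem _ (lc f' / lc g)
      (mul_mul_mem_standardSpan (s := Iio w) hg hg0 (a := a) (b := b) (e ▸ hlt))
    simpa using add_mem hrw this

lemma IsGroebnerBasis.reducesToZero [WellFoundedLT (FreeMonoid (Fin n))]
    {I : TwoSidedIdeal (NCPoly K n)} (h : IsGroebnerBasis G I) {f : NCPoly K n} (hf : f ∈ I) :
    ReducesToZero G f := by
  induction hw : lt f using WellFoundedLT.induction generalizing f with
  | ind w ih =>
    by_cases hf0 : f = 0
    · exact hf0 ▸ Relation.ReflTransGen.refl
    obtain ⟨g, hg, hg0, a, b, e⟩ := h.2 f hf hf0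
    have hr : IsReduction g f (f - (lc f / lc g) • (mon a * g * mon b)) :=
      ⟨hf0, hg0, a, b, e, rfl⟩
    refine Relation.ReflTransGen.head ⟨g, hg, hr⟩ ?_
    by_cases hr0 : f - (lc f / lc g) • (mon a * g * mon b) = 0
    · rw [hr0]
    · exact ih _ (hw ▸ lt_lt_of_mem_below hr0 hr.mem_below) ((hr.mem_iff (h.1 hg)).2 hf) rfl

/-! ### Products with the same leading monomial -/

/-- Disjoint occurrences need no hypothesis on `G`: if `p = mon (lt p) + p'` and
`q = mon (lt q) + q'` are the normalized polynomials, then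
`p * d * lt q - lt p * d * q = p' * d * q - p * d * q'`. -/
lemma disjoint_sub_mem_standardSpan {f g : NCPoly K n} (hf : f ∈ G) (hf0 : f ≠ 0) (hg : g ∈ G)
    (hg0 : g ≠ 0) (d : FreeMonoid (Fin n)) :
    (lc f)⁻¹ • (f * mon (d * lt g)) - (lc g)⁻¹ • (mon (lt f * d) * g) ∈
      standardSpan G (Iio (lt f * d * lt g)) := by
  have h1 := Submodule.smul_mem _ (lc f)⁻¹
    (mul_mul_mem_standardSpan_of_right_mem_below hf hf0 (d := d) (inv_lc_smul_sub_mem_below hg0))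
  have h2 := Submodule.smul_mem _ (lc g)⁻¹
    (mul_mul_mem_standardSpan_of_left_mem_below hg hg0 (d := d) (inv_lc_smul_sub_mem_below hf0))
  convert sub_mem h2 h1 using 1
  simp only [mon_mul, sub_mul, mul_sub, smul_sub, smul_mul_assoc, mul_smul_comm, mul_assoc]
  rw [smul_comm (lc g)⁻¹ (lc f)⁻¹]
  abel

/-- If all reductions and S-polynomials of elements of `G` reduce to `0`, then the difference of
two normalized products with the same leading monomial `f₀ * b = c * g₀ * d`, the first of which
starts with an element of `G`, is a combination of products with smaller leading monomials. -/
lemma normalized_sub_mem_standardSpan_of_prefix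
    (hR : ∀ g₁ ∈ G, ∀ g₂ ∈ G, ∀ r, IsReduction g₂ g₁ r → ReducesToZero G r)
    (hS : ∀ g₁ ∈ G, ∀ g₂ ∈ G, ∀ s, IsSPolynomial g₁ g₂ s → ReducesToZero G s)
    {f g : NCPoly K n} (hf : f ∈ G) (hf0 : f ≠ 0) (hg : g ∈ G) (hg0 : g ≠ 0)
    {b c d : FreeMonoid (Fin n)} (e : lt f * b = c * (lt g * d)) :
    (lc f)⁻¹ • (f * mon b) - (lc g)⁻¹ • (mon c * g * mon d) ∈
      standardSpan G (Iio (lt f * b)) := by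
  rcases exists_of_mul_eq_mul e with ⟨x, rfl, rfl⟩ | ⟨x, hx, hxb⟩
  · -- `lt g` starts after the end of `lt f`
    have := mon_mul_mul_mon_mem_standardSpan (a := 1) (b := d)
      (t := Iio (lt f * (x * (lt g * d)))) (fun w hw => by
        have := mul_mul_lt_mul_mul (mem_Iio.1 hw) 1 d
        simpa only [one_mul, mul_assoc, mem_Iio] using this)
      (disjoint_sub_mem_standardSpan hf hf0 hg hg0 x)
    simpa only [mon_one, one_mul, mon_mul, sub_mul, smul_mul_assoc, mul_assoc] using this
  · rcases exists_of_mul_eq_mul hxb with ⟨y, rfl, rfl⟩ | ⟨y, hy, rfl⟩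
    · -- `lt g` lies inside `lt f`
      have hr : IsReduction g f (f - (lc f / lc g) • (mon c * g * mon y)) :=
        ⟨hf0, hg0, c, y, by rw [hx, mul_assoc], rfl⟩
      have hm := Submodule.smul_mem _ (lc f)⁻¹
        ((hR f hf g hg _ hr).mem_standardSpan hr.mem_below)
      have := mon_mul_mul_mon_mem_standardSpan (a := 1) (b := b) (t := Iio (lt f * b))
        (fun w hw => by
          have := mul_mul_lt_mul_mul (mem_Iio.1 hw) 1 b
          simpa only [one_mul, mem_Iio] using this) hm
      convert this using 1
      have hc : (lc f)⁻¹ * (lc f / lc g) = (lc g)⁻¹ := by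
        have := lc_ne_zero hf0
        field_simp
      simp only [mon_one, one_mul, smul_sub, smul_smul, hc, sub_mul, smul_mul_assoc, mon_mul,
        mul_assoc]
    · -- `lt g` ends after the end of `lt f`
      by_cases hx1 : x = 1
      · -- the occurrences are adjacent, and no small common multiple arises
        subst hx1
        have hxy : y = lt g := by simpa using hy.symm
        subst hxy
        have hc : lt f = c := by simpa using hx
        subst hc
        have := mon_mul_mul_mon_mem_standardSpan (a := 1) (b := d)
          (t := Iio (lt f * (lt g * d))) (fun w hw => by
            have := mul_mul_lt_mul_mul (mem_Iio.1 hw) 1 d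
            simpa only [one_mul, mul_one, mul_assoc, mem_Iio] using this)
          (disjoint_sub_mem_standardSpan hf hf0 hg hg0 1)
        simpa only [mon_one, one_mul, mul_one, mon_mul, sub_mul, smul_mul_assoc, mul_assoc]
          using this
      have hey : lt f * y = c * lt g := by rw [hx, hy, mul_assoc]
      have hlen : c.length < (lt f).length := by
        rw [hx, FreeMonoid.length_mul]
        have := FreeMonoid.length_eq_zero.not.2 hx1
        omega
      have hm := (hS f hf g hg _ ⟨hf0, hg0, c, y, hey, hlen, rfl⟩).mem_standardSpan
        (sPolynomial_mem_below hf0 hg0 hey)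
      have := mon_mul_mul_mon_mem_standardSpan (a := 1) (b := d) (t := Iio (lt f * (y * d)))
        (fun w hw => by
          have := mul_mul_lt_mul_mul (mem_Iio.1 hw) 1 d
          simpa only [one_mul, mul_assoc, mem_Iio] using this) hm
      simpa only [mon_one, one_mul, mon_mul, sub_mul, smul_mul_assoc, mul_assoc] using this

/-- If all reductions and S-polynomials of elements of `G` reduce to `0`, then two products with
the same leading monomial `w` agree, once normalized, up to products with smaller leading
monomials. -/
lemma normalized_sub_mem_standardSpan
    (hR : ∀ g₁ ∈ G, ∀ g₂ ∈ G, ∀ r, IsReduction g₂ g₁ r → ReducesToZero G r)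
    (hS : ∀ g₁ ∈ G, ∀ g₂ ∈ G, ∀ s, IsSPolynomial g₁ g₂ s → ReducesToZero G s)
    {f g : NCPoly K n} (hf : f ∈ G) (hf0 : f ≠ 0) (hg : g ∈ G) (hg0 : g ≠ 0)
    {a b c d w : FreeMonoid (Fin n)} (e1 : a * lt f * b = w) (e2 : c * lt g * d = w) :
    (lc f)⁻¹ • (mon a * f * mon b) - (lc g)⁻¹ • (mon c * g * mon d) ∈
      standardSpan G (Iio w) := by
  have key : ∀ {f g : NCPoly K n}, f ∈ G → f ≠ 0 → g ∈ G → g ≠ 0 →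
      ∀ {a b x d : FreeMonoid (Fin n)}, a * lt f * b = w → lt f * b = x * (lt g * d) →
      (lc f)⁻¹ • (mon a * f * mon b) - (lc g)⁻¹ • (mon (a * x) * g * mon d) ∈
        standardSpan G (Iio w) := by
    intro f g hf hf0 hg hg0 a b x d e1 e
    have := mon_mul_mul_mon_mem_standardSpan (a := a) (b := 1) (t := Iio w) (fun u hu => by
        have := mul_mul_lt_mul_mul (mem_Iio.1 hu) a 1
        simpa only [← e1, mul_one, mul_assoc, mem_Iio] using this)
      (normalized_sub_mem_standardSpan_of_prefix hR hS hf hf0 hg hg0 e)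
    simpa only [mon_one, mul_one, mon_mul, mul_sub,
      mul_smul_comm, mul_assoc] using this
  have e : a * (lt f * b) = c * (lt g * d) := by rw [← mul_assoc, e1, ← mul_assoc, e2]
  rcases exists_of_mul_eq_mul e with ⟨x, rfl, h⟩ | ⟨x, rfl, h⟩
  · exact key hf hf0 hg hg0 e1 h
  · rw [← neg_sub]
    exact neg_mem (key hg hg0 hf hf0 e2 h)

/-! ### Leading monomials of the ideal -/

/-- Modulo `standardSpan G (Iio w)`, the space `standardSpan G (Iic w)` is at most a line, spanned
by a normalized product with leading monomial `w`. -/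
lemma mem_standardSpan_Iio_or_exists_of_mem_Iic
    (hR : ∀ g₁ ∈ G, ∀ g₂ ∈ G, ∀ r, IsReduction g₂ g₁ r → ReducesToZero G r)
    (hS : ∀ g₁ ∈ G, ∀ g₂ ∈ G, ∀ s, IsSPolynomial g₁ g₂ s → ReducesToZero G s)
    {w : FreeMonoid (Fin n)} {f : NCPoly K n} (hf : f ∈ standardSpan G (Iic w)) :
    f ∈ standardSpan G (Iio w) ∨ ∃ g ∈ G, g ≠ 0 ∧ ∃ a b : FreeMonoid (Fin n),
      a * lt g * b = w ∧ ∃ k : K,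
        f - k • ((lc g)⁻¹ • (mon a * g * mon b)) ∈ standardSpan G (Iio w) := by
  by_cases hw : ∃ g ∈ G, g ≠ 0 ∧ ∃ a b : FreeMonoid (Fin n), a * lt g * b = w
  · obtain ⟨g, hg, hg0, a, b, e⟩ := hw
    refine Or.inr ⟨g, hg, hg0, a, b, e, ?_⟩
    induction hf using Submodule.span_induction with
    | mem x hx =>
      obtain ⟨g', hg', hg0', c, d, hs, rfl⟩ := hx
      rcases (mem_Iic.1 hs).lt_or_eq with hs | hs
      · exact ⟨0, by simpa using mul_mul_mem_standardSpan (s := Iio w) hg' hg0' hs⟩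
      · refine ⟨lc g', ?_⟩
        have := Submodule.smul_mem _ (lc g')
          (normalized_sub_mem_standardSpan hR hS hg' hg0' hg hg0 hs e)
        rwa [smul_sub, smul_smul (lc g'), mul_inv_cancel₀ (lc_ne_zero hg0'), one_smul] at this
    | zero => exact ⟨0, by simp⟩
    | add x y _ _ hx hy =>
      obtain ⟨k, hk⟩ := hx
      obtain ⟨l, hl⟩ := hy
      refine ⟨k + l, ?_⟩
      rw [add_smul, add_sub_add_comm]
      exact add_mem hk hl
    | smul c x _ hx =>
      obtain ⟨k, hk⟩ := hx
      refine ⟨c * k, ?_⟩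
      rw [mul_smul, ← smul_sub]
      exact Submodule.smul_mem _ _ hk
  · left
    refine Submodule.span_mono ?_ hf
    rintro _ ⟨g, hg, hg0, a, b, hs, rfl⟩
    exact ⟨g, hg, hg0, a, b, lt_of_le_of_ne hs fun e => hw ⟨g, hg, hg0, a, b, e⟩, rfl⟩

lemma exists_lt_eq_of_mem_standardSpan_Iic [WellFoundedLT (FreeMonoid (Fin n))]
    (hR : ∀ g₁ ∈ G, ∀ g₂ ∈ G, ∀ r, IsReduction g₂ g₁ r → ReducesToZero G r)
    (hS : ∀ g₁ ∈ G, ∀ g₂ ∈ G, ∀ s, IsSPolynomial g₁ g₂ s → ReducesToZero G s)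
    {w : FreeMonoid (Fin n)} {f : NCPoly K n} (hf0 : f ≠ 0) (hf : f ∈ standardSpan G (Iic w)) :
    ∃ g ∈ G, g ≠ 0 ∧ ∃ a b : FreeMonoid (Fin n), lt f = a * lt g * b := by
  induction w using WellFoundedLT.induction with
  | ind w ih =>
    have hlow : f ∈ standardSpan G (Iio w) →
        ∃ g ∈ G, g ≠ 0 ∧ ∃ a b : FreeMonoid (Fin n), lt f = a * lt g * b := by
      intro h
      obtain h | ⟨u, hu, h⟩ := eq_zero_or_exists_mem_standardSpan_Iic h
      · exact absurd h hf0
      · exact ih u hu h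
    rcases mem_standardSpan_Iio_or_exists_of_mem_Iic hR hS hf with h | ⟨g, hg, hg0, a, b, e, k, h⟩
    · exact hlow h
    by_cases hk : k = 0
    · exact hlow (by simpa [hk] using h)
    -- the leading term `k • mon w` of the product survives in `f`
    refine ⟨g, hg, hg0, a, b, e ▸ lt_eq_of_sub_mem_below hk ?_⟩
    have h1 := standardSpan_Iio_le_below _ h
    have h2 := Submodule.smul_mem _ (k * (lc g)⁻¹) (mul_mul_sub_mem_below g a b)
    rw [e, smul_sub, smul_smul, inv_mul_cancel_right₀ (lc_ne_zero hg0)] at h2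
    rw [smul_smul] at h1
    simpa using add_mem h1 h2

end Ordered

end NCGroebner

theorem mainTheorem5 {K : Type*} [Field K] {n : ℕ}
    [LinearOrder (FreeMonoid (Fin n))] [WellFoundedLT (FreeMonoid (Fin n))]
    [MulLeftStrictMono (FreeMonoid (Fin n))] [MulRightStrictMono (FreeMonoid (Fin n))]
    (I : TwoSidedIdeal (NCGroebner.NCPoly K n)) (G : Set (NCGroebner.NCPoly K n))
    (hG : G ⊆ (I : Set (NCGroebner.NCPoly K n))) :
    NCGroebner.IsGroebnerBasis G I ↔
      TwoSidedIdeal.span G = I ∧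
      (∀ g₁ ∈ G, ∀ g₂ ∈ G, ∀ r : NCGroebner.NCPoly K n,
        NCGroebner.IsReduction g₂ g₁ r → NCGroebner.ReducesToZero G r) ∧
      (∀ g₁ ∈ G, ∀ g₂ ∈ G, ∀ s : NCGroebner.NCPoly K n,
        NCGroebner.IsSPolynomial g₁ g₂ s → NCGroebner.ReducesToZero G s) := by
  constructor
  · intro h
    refine ⟨le_antisymm (TwoSidedIdeal.span_le.2 hG) fun f hf =>
        (h.reducesToZero hf).mem TwoSidedIdeal.subset_span, ?_, ?_⟩
    · intro g₁ h₁ g₂ h₂ r hr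
      exact h.reducesToZero ((hr.mem_iff (hG h₂)).2 (hG h₁))
    · rintro g₁ h₁ g₂ h₂ _ ⟨-, -, a, b, -, -, rfl⟩
      refine h.reducesToZero (I.sub_mem ?_ ?_)
      · rw [← smul_mul_assoc, ← smul_one_mul]
        exact I.mul_mem_right _ _ (I.mul_mem_left _ _ (hG h₁))
      · rw [← smul_mul_assoc]
        exact I.mul_mem_left _ _ (hG h₂)
  · rintro ⟨hI, hR, hS⟩
    refine ⟨hG, fun f hf hf0 => ?_⟩
    obtain h | ⟨w, -, h⟩ := NCGroebner.eq_zero_or_exists_mem_standardSpan_Iic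
      (NCGroebner.mem_standardSpan_univ_of_mem_span (hI ▸ hf))
    · exact absurd h hf0
    · exact NCGroebner.exists_lt_eq_of_mem_standardSpan_Iic hR hS hf0 h
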